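/- Let $G=(V,E)$ be a finite, non-empty, connected, planar, trivalent multigraph (loops and multiple edges are allowed, a loop counts twice in the degree, and there are no vertexless circles), and let $\Gamma$ be a plane graph for $G$, that is, a ribbon graph of $G$ (a cyclic ordering of the half-edges at every vertex and a sign for every edge) whose associated closed surface, obtained by gluing discs to all boundary circles, is the sphere. Then $$\dim_{\mathbb C} \widehat{VCH}{}_2^{0}(\Gamma) = 2\cdot \#\{\text{perfect matchings of } G\},$$ where a perfect matching is a set of non-loop edges such that every vertex is incident to exactly one of them, and $\widehat{VCH}{}_2^{*}(\Gamma)$ is the filtered $2$-color vertex homology of $\Gamma$ over $\mathbb C$, which is the case $n=2$ of the following. States and circles: assign to every half-edge of $\Gamma$ a $0$-smoothing (its two strands are parallel) or a $1$-smoothing (its two strands cross). Together with the strands around the corners of the vertices and an additional crossing on every edge of negative sign, this gives a set of immersed circles; when all half-edges are $0$-smoothed, these are the boundary circles of the faces of $\Gamma$. For $\nu\in\{0,1\}^{V}$ let $\Gamma_\nu$ be the state in which the three half-edges at $v$ are $\nu_v$-smoothed, for every $v\in V$. Let $\widehat V=\mathbb C[x]/(x^n-1)$, let $k_\nu$ be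 the number of circles of $\Gamma_\nu$, let $\widehat V_\nu=\widehat V^{\otimes k_\nu}$ with one factor for each circle, and let $\widehat C_n^i(\Gamma)=\bigoplus_{|\nu|=i}\widehat V_\nu$. Differential: put $m=\lfloor n/2\rfloor$. Changing the smoothing of one half-edge from $0$ to $1$ induces the linear map that is the identity on the factors of unaffected circles and, on those of the affected circles, is $x^i\otimes x^j\mapsto x^{i+j}$ if two circles merge, $x^k\mapsto\sum_{0\le i,j<n,\ i+j\equiv k+2m \ (\mathrm{mod}\ n)}x^i\otimes x^j$ if one circle splits into two, and $x^k\mapsto\sqrt n\,x^{k+m}$ if one circle becomes one circle. If $\nu'$ arises from $\nu$ by changing $\nu_v=0$ to $\nu'_v=1$ at a single vertex $v$, then $\widehat\delta_{\nu\nu'}:\widehat V_\nu\to\widehat V_{\nu'}$ is the composition of the maps for the three half-edges at $v$, taken in any order. With respect to a fixed linear order on $V$, $\widehat\delta=\sum_{\nu\to\nu'}(-1)^{\#\{u<v\,:\,\nu_u=1\}}\,\widehat\delta_{\nu\nu'}$, and $\widehat{VCH}{}_n^{i}(\Gamma)$ is the $i$-th cohomology of $(\widehat C_n^{*}(\Gamma),\widehat\delta)$.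 The statement holds for every order on $V$ and for every choice of the orders of the half-edges at the vertices. -/

import Mathlib

open scoped Graph

noncomputable section

namespace VertexHomology

universe u v w

/-! ### Multigraphs -/

/-- A multigraph is connected if it is non-empty and any two vertices are joined by a walk. -/
def IsConnected {V : Type u} {E : Type v} (G : Graph V E) : Prop :=
  V(G).Nonempty ∧ ∀ x ∈ V(G), ∀ y ∈ V(G), Relation.ReflTransGen G.Adj x y

/-- A multigraph is trivalent if every vertex has degree three, a loop counting twice. -/
def IsTrivalent {V : Type u} {E : Type v} (G : Graph V E) : Prop :=
  ∀ x ∈ V(G), (G.incidenceSet x).encard + (G.loopSet x).encard = 3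

/-- A perfect matching is a set of non-loop edges such that every vertex is incident to exactly
one edge of the set. -/
def IsPerfectMatching {V : Type u} {E : Type v} (G : Graph V E) (M : Set E) : Prop :=
  (∀ e ∈ M, e ∈ E(G) ∧ ∀ x, ¬ G.IsLoopAt e x) ∧ ∀ x ∈ V(G), ∃! e, e ∈ M ∧ G.Inc e x

/-! ### Ribbon graphs -/

/-- A ribbon graph of the multigraph `G`, given by a cyclic ordering of the half-edges at every
vertex and a sign for every edge (a signed rotation system). The type of half-edges is `D`; a loop
consists of two distinct half-edges at the same vertex. The surface of the ribbon graph has a disc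
for every vertex and a band for every edge, with a half-twist in the band if `twisted`. -/
structure RibbonGraph {V : Type u} {E : Type v} (G : Graph V E) (D : Type w) where
  /-- the vertex at which a half-edge is attached -/
  vert : D → V
  /-- the edge to which a half-edge belongs -/
  edge : D → E
  /-- the other half of the same edge -/
  opp : D → D
  opp_opp : ∀ d, opp (opp d) = d
  opp_ne : ∀ d, opp d ≠ d
  edge_eq_iff : ∀ d d', edge d = edge d' ↔ d' = d ∨ d' = opp d
  isLink : ∀ d, G.IsLink (edge d) (vert d) (vert (opp d))
  exists_edge : ∀ e ∈ E(G), ∃ d, edge d = e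
  /-- the next half-edge in the cyclic ordering at the vertex -/
  rot : Equiv.Perm D
  /-- the half-edges at a vertex form a single cycle of `rot` -/
  rot_sameCycle : ∀ d d', rot.SameCycle d d' ↔ vert d = vert d'
  /-- the edges with negative sign -/
  twisted : E → Bool

namespace RibbonGraph

variable {V : Type u} {E : Type v} {D : Type w} {G : Graph V E}

/-- A state of the bubbled blowup of `Γ`. The perfect matching edges of the bubbled blowup are the
half-edges of `Γ`; each of them carries its `0`-smoothing (`false`) or its
`1`-smoothing (`true`). -/
abbrev State (_Γ : RibbonGraph G D) : Type w := D → Bool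

/-- The two strands running along the half-edge `d`, seen from its vertex looking outward, are
`(d, true)`, on the side of the next half-edge `rot d`, and `(d, false)`, on the other side.
Two strands are joined around a vertex when they bound the same corner. Along an edge, untwisted
and with both of its halves `0`-smoothed, the strands are parallel, which exchanges the two sides
as the point of view changes to the other end. A negative sign, and each `1`-smoothing of a
half of the edge, makes the two strands cross once. -/
inductive Joined (Γ : RibbonGraph G D) (a : Γ.State) : D × Bool → D × Bool → Prop
  | corner (d : D) : Joined Γ a (d, true) (Γ.rot d, false)
  | along (d : D) (b : Bool) : Joined Γ a (d, b)
      (Γ.opp d, Bool.xor (!b) (Bool.xor (Γ.twisted (Γ.edge d)) (Bool.xor (a d) (a (Γ.opp d)))))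

/-- The immersed circles of a state: the classes of strands that are joined to one another. -/
def Circle (Γ : RibbonGraph G D) (a : Γ.State) : Type w :=
  Quotient (Relation.EqvGen.setoid (Γ.Joined a))

/-- The circle through a given strand. -/
def circle (Γ : RibbonGraph G D) (a : Γ.State) (s : D × Bool) : Γ.Circle a :=
  Quotient.mk _ s

instance (Γ : RibbonGraph G D) (a : Γ.State) [Finite D] : Finite (Γ.Circle a) :=
  inferInstanceAs (Finite (Quotient _))

/-- The faces of `Γ` are the discs glued to the boundary circles of its surface; these are the
circles of the all-zero state. -/
abbrev Face (Γ : RibbonGraph G D) : Type w := Γ.Circle fun _ => false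

/-- A ribbon graph of `G` is a plane graph if `G` is connected and the closed surface obtained by
gluing a disc to every boundary circle is a sphere, that is, it has Euler characteristic two.
(`G` is supposed to have no isolated vertices.) -/
def IsPlane (Γ : RibbonGraph G D) : Prop :=
  IsConnected G ∧ (V(G).ncard : ℤ) - (E(G).ncard : ℤ) + (Nat.card Γ.Face : ℤ) = 2

/-! ### The filtered maps on the hypercube of the bubbled blowup -/

/-- The standard basis of `V̂ ^ ⊗ k`, where `V̂ = ℂ[x] / (x ^ n - 1)` has the basis
`1, x, …, x ^ (n - 1)` and the tensor factors are labelled by the `k` circles of the state `a`: a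
tensor product of monomials is given by the exponent of `x`, modulo `n`, at every circle. -/
abbrev Monomial (Γ : RibbonGraph G D) (n : ℕ) (a : Γ.State) : Type w := Γ.Circle a → ZMod n

open scoped Classical in
/-- The matrix, in the monomial bases, of the filtered map `∂ + ∂~` from the state `a` to the state
`b` that differs from `a` in that the half-edge `d` is `1`-smoothed in `b` and
`0`-smoothed in `a`. It is the identity on the circles that do not run along `d`. On the others
it is, where `m = ⌊n / 2⌋` and exponents are taken modulo `n`, since `x ^ n = 1`,
* `x ^ i ⊗ x ^ j ↦ x ^ (i + j)` if two circles merge into one,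
* `x ^ k ↦ ∑ x ^ i ⊗ x ^ j`, over all `i + j = k + 2 m`, if one circle splits into two,
* `x ^ k ↦ √n x ^ (k + m)` if one circle becomes one circle.
The terms in which the integer exponents (between `0` and `n - 1`) satisfy the stated equality
itself form the part `∂` of degree zero; those in which they satisfy it up to subtracting `n`
form the part `∂~` of degree `n`. -/
def halfEdgeMap (Γ : RibbonGraph G D) (n : ℕ) (d : D) (a b : Γ.State) :
    Matrix (Γ.Monomial n b) (Γ.Monomial n a) ℂ :=
  Matrix.of fun J I =>
    if ∀ s, Γ.circle a s ≠ Γ.circle a (d, false) → Γ.circle a s ≠ Γ.circle a (d, true) →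
        J (Γ.circle b s) = I (Γ.circle a s) then
      if Γ.circle a (d, false) ≠ Γ.circle a (d, true) then
        if J (Γ.circle b (d, false)) = I (Γ.circle a (d, false)) + I (Γ.circle a (d, true))
          then 1 else 0
      else if Γ.circle b (d, false) ≠ Γ.circle b (d, true) then
        if J (Γ.circle b (d, false)) + J (Γ.circle b (d, true)) =
            I (Γ.circle a (d, false)) + ((2 * (n / 2) : ℕ) : ZMod n) then 1 else 0
      else
        if J (Γ.circle b (d, false)) = I (Γ.circle a (d, false)) + ((n / 2 : ℕ) : ZMod n)
          then ((Real.sqrt n : ℝ) : ℂ) else 0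
    else 0

/-! ### The hypercube of vertex states and its filtered complex -/

open scoped Classical in
/-- The state of the bubbled blowup corresponding to the vertex state in which the vertices in `ν`
are `1`-smoothed and the others are `0`-smoothed: a vertex `1`-smoothing is a `1`-smoothing of
all the half-edges at the vertex. -/
def vertexState (Γ : RibbonGraph G D) (ν : Finset V) : Γ.State :=
  fun d => decide (Γ.vert d ∈ ν)

/-- A choice, for every vertex, of the order in which its three half-edges are smoothed, that is,
of one of the six paths of three edges in the hypercube of the bubbled blowup which lead
from the `0`-smoothing to the `1`-smoothing of the vertex. -/
abbrev PathChoice (Γ : RibbonGraph G D) : Type (max u w) :=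
  ∀ x : V(G), Fin 3 ≃ {d : D // Γ.vert d = x}

open scoped Classical in
/-- The matrix of the local filtered map from the vertex state `ν` to the vertex state `ν'` that
differs from it in a `1`-smoothing at `x`: the composition of the maps of the three edges of the
chosen path in the hypercube of the bubbled blowup. -/
def vertexMap [Finite D] (Γ : RibbonGraph G D) (p : Γ.PathChoice) (n : ℕ) [NeZero n]
    (x : V(G)) (ν ν' : Finset V) :
    Matrix (Γ.Monomial n (Γ.vertexState ν')) (Γ.Monomial n (Γ.vertexState ν)) ℂ :=
  letI (a : Γ.State) : Fintype (Γ.Monomial n a) := Fintype.ofFinite _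
  let a₁ : Γ.State := Function.update (Γ.vertexState ν) (p x 0) true
  let a₂ : Γ.State := Function.update a₁ (p x 1) true
  Γ.halfEdgeMap n (p x 2) a₂ (Γ.vertexState ν') * Γ.halfEdgeMap n (p x 1) a₁ a₂ *
    Γ.halfEdgeMap n (p x 0) (Γ.vertexState ν) a₁

/-- The standard basis of the chain group of degree `i`, the direct sum over the vertex states with
exactly `i` vertices `1`-smoothed of the spaces `V̂ ^ ⊗ k`, where `k` is the number of circles. -/
abbrev Generator (Γ : RibbonGraph G D) (n : ℕ) (i : ℤ) : Type (max u w) :=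
  Σ ν : {ν : Finset V // (ν : Set V) ⊆ V(G) ∧ (ν.card : ℤ) = i}, Γ.Monomial n (Γ.vertexState ν.1)

/-- The chain group of degree `i` of the filtered complex, in coordinates with respect to its
standard basis. It is zero unless `0 ≤ i ≤ |V|`. -/
abbrev Chain (Γ : RibbonGraph G D) (n : ℕ) (i : ℤ) : Type (max u w) := Γ.Generator n i → ℂ

open scoped Classical in
/-- The filtered differential from degree `i` to degree `j`, meant for `j = i + 1`: the signed sum
of the local maps over the edges of the hypercube of vertex states. The sign is given by the
parity of the number of `1`-smoothed vertices that precede the vertex being changed. -/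
def differential [Fintype V] [LinearOrder V] [Finite D] (Γ : RibbonGraph G D) (p : Γ.PathChoice)
    (n : ℕ) [NeZero n] (i j : ℤ) : Γ.Chain n i →ₗ[ℂ] Γ.Chain n j :=
  letI : Fintype (Γ.Generator n i) := Fintype.ofFinite _
  Matrix.mulVecLin <| Matrix.of fun (g' : Γ.Generator n j) (g : Γ.Generator n i) =>
    ∑ x : V(G), if (x : V) ∉ g.1.1 ∧ g'.1.1 = insert (x : V) g.1.1 then
      (-1 : ℂ) ^ (g.1.1.filter fun y => y < (x : V)).card *
        Γ.vertexMap p n x g.1.1 g'.1.1 g'.2 g.2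
    else 0

/-- The filtered `n`-color vertex homology in degree `i`: the kernel of the outgoing differential
modulo the image of the incoming one. (The square of the differential is zero; so that this need
not be known in order to form the quotient, the image is intersected with the kernel.) -/
abbrev FilteredVertexHomology [Fintype V] [LinearOrder V] [Finite D] (Γ : RibbonGraph G D)
    (p : Γ.PathChoice) (n : ℕ) [NeZero n] (i : ℤ) : Type (max u w) :=
  LinearMap.ker (Γ.differential p n i (i + 1)) ⧸
    (LinearMap.range (Γ.differential p n (i - 1) i)).submoduleOf
      (LinearMap.ker (Γ.differential p n i (i + 1)))

end RibbonGraph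

end VertexHomology

end

open scoped Graph

noncomputable section

namespace VertexHomology

universe u v w

namespace RibbonGraph

variable {V : Type u} {E : Type v} {D : Type w} {G : Graph V E}

/-! ### Changing the smoothing of one half-edge -/

/-! Since there are no chains of degree -1, the homology in degree zero is the kernel of the
differential, which is the intersection of the kernels of the local maps at the vertices. For `n =
2` the algebra ℂ[x]/(x²-1) is semisimple, so its tensor powers have a basis of common eigenvectors
of all multiplications by x: one vector for each coloring of the circles by ±1, in degree zero one
for each coloring of the faces.

A half-edge map commutes with x at every strand (`halfEdgeMap_add_single`), so it respects colors.
It kills a coloring whose two strands along the half-edge differ (`IsColored.mulVec_eq_zero`),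
because these strands share a circle before or after the change; it does not kill the others
(`IsColored.mulVec_apply_zero_ne_zero`). By `finrank_iInf_ker_eq_card` the kernel is therefore
spanned by the face colorings for which every vertex has a half-edge with different colors on its
two sides.

Going around a vertex, the color changes an even number of times. With three half-edges and at least
one change there are exactly two changes, so the edges with equal sides form a perfect matching.
Conversely, the complement of a perfect matching is a cycle modulo two; on the sphere it bounds a
set of faces (`IsPlane.range_faceCoboundary`), unique up to complement. This gives the factor 2. -/

/-- The states `a` and `b` differ exactly in the smoothing of the half-edge `d`. -/
def DiffersAt (Γ : RibbonGraph G D) (a b : Γ.State) (d : D) : Prop :=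
  b d = !a d ∧ ∀ d', d' ≠ d → b d' = a d'

lemma DiffersAt.symm {Γ : RibbonGraph G D} {a b : Γ.State} {d : D} (h : Γ.DiffersAt a b d) :
    Γ.DiffersAt b a d :=
  ⟨by simp [h.1], fun d' hd' => (h.2 d' hd').symm⟩

/-- The circle through the strand `s` runs along the half-edge `d`. -/
def Touches (Γ : RibbonGraph G D) (a : Γ.State) (d : D) (s : D × Bool) : Prop :=
  Γ.circle a s = Γ.circle a (d, false) ∨ Γ.circle a s = Γ.circle a (d, true)

lemma circle_eq_of_joined {Γ : RibbonGraph G D} {a : Γ.State} {s t : D × Bool}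
    (h : Γ.Joined a s t) : Γ.circle a s = Γ.circle a t :=
  Quotient.sound (.rel _ _ h)

lemma circle_corner (Γ : RibbonGraph G D) (a : Γ.State) (d : D) :
    Γ.circle a (d, true) = Γ.circle a (Γ.rot d, false) :=
  circle_eq_of_joined (.corner d)

lemma touches_self (Γ : RibbonGraph G D) (a : Γ.State) (d : D) (β : Bool) :
    Γ.Touches a d (d, β) := by
  cases β
  · exact .inl rfl
  · exact .inr rfl

lemma touches_congr {Γ : RibbonGraph G D} {a : Γ.State} {d : D} {s t : D × Bool}
    (h : Γ.circle a s = Γ.circle a t) : Γ.Touches a d s ↔ Γ.Touches a d t := by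
  simp only [Touches, h]

lemma edge_opp (Γ : RibbonGraph G D) (d : D) : Γ.edge (Γ.opp d) = Γ.edge d :=
  ((Γ.edge_eq_iff d (Γ.opp d)).2 (.inr rfl)).symm

/-- The partner of a strand along its edge. -/
def across (Γ : RibbonGraph G D) (a : Γ.State) (s : D × Bool) : D × Bool :=
  (Γ.opp s.1, Bool.xor (!s.2)
    (Bool.xor (Γ.twisted (Γ.edge s.1)) (Bool.xor (a s.1) (a (Γ.opp s.1)))))

lemma across_across (Γ : RibbonGraph G D) (a : Γ.State) (s : D × Bool) :
    Γ.across a (Γ.across a s) = s := by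
  obtain ⟨d, β⟩ := s
  simp only [across, Γ.opp_opp, edge_opp, Prod.mk.injEq, true_and]
  cases β <;> cases Γ.twisted (Γ.edge d) <;> cases a d <;> cases a (Γ.opp d) <;> rfl

lemma across_ne (Γ : RibbonGraph G D) (a : Γ.State) (s : D × Bool) : Γ.across a s ≠ s :=
  fun h => Γ.opp_ne s.1 (congrArg Prod.fst h)

lemma circle_across (Γ : RibbonGraph G D) (a : Γ.State) (s : D × Bool) :
    Γ.circle a (Γ.across a s) = Γ.circle a s :=
  (circle_eq_of_joined (.along s.1 s.2)).symm

/-- The partner of a strand around the corner of its vertex. -/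
def around (Γ : RibbonGraph G D) (s : D × Bool) : D × Bool :=
  if s.2 then (Γ.rot s.1, false) else (Γ.rot.symm s.1, true)

lemma around_around (Γ : RibbonGraph G D) (s : D × Bool) : Γ.around (Γ.around s) = s := by
  obtain ⟨d, β⟩ := s
  cases β <;> simp [around]

lemma around_ne (Γ : RibbonGraph G D) (s : D × Bool) : Γ.around s ≠ s := by
  obtain ⟨d, β⟩ := s
  cases β <;> simp [around]

lemma circle_around (Γ : RibbonGraph G D) (a : Γ.State) (s : D × Bool) :
    Γ.circle a (Γ.around s) = Γ.circle a s := by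
  obtain ⟨d, β⟩ := s
  cases β
  · simpa [around] using Γ.circle_corner a (Γ.rot.symm d)
  · simpa [around] using (Γ.circle_corner a d).symm

/-- A relation that contains the joins of strands contains all pairs of strands on one circle. -/
lemma rel_of_circle_eq {Γ : RibbonGraph G D} {a : Γ.State} {r : D × Bool → D × Bool → Prop}
    (hr : Equivalence r) (h : ∀ s t, Γ.Joined a s t → r s t) {s t : D × Bool}
    (hst : Γ.circle a s = Γ.circle a t) : r s t :=
  hr.eqvGen_iff.1 (Relation.EqvGen.mono h _ _ (Quotient.exact hst))

lemma across_eq_of_differsAt {Γ : RibbonGraph G D} {a b : Γ.State} {d : D}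
    (h : Γ.DiffersAt a b d) {s : D × Bool} (h₁ : s.1 ≠ d) (h₂ : Γ.opp s.1 ≠ d) :
    Γ.across b s = Γ.across a s := by
  simp only [across, h.2 _ h₁, h.2 _ h₂]

lemma across_self_of_differsAt {Γ : RibbonGraph G D} {a b : Γ.State} {d : D}
    (h : Γ.DiffersAt a b d) (β : Bool) : Γ.across b (d, β) = Γ.across a (d, !β) := by
  simp only [across, h.1, h.2 _ (Γ.opp_ne d), Prod.mk.injEq, true_and]
  cases β <;> cases Γ.twisted (Γ.edge d) <;> cases a d <;> cases a (Γ.opp d) <;> rfl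

/-- The two states have the same joins except along the edge of `d`, and all four strands of that
edge lie on circles through `d`. -/
lemma circle_eq_or_touches {Γ : RibbonGraph G D} {a b : Γ.State} {d : D}
    (h : Γ.DiffersAt a b d) {s t : D × Bool} (hst : Γ.circle a s = Γ.circle a t) :
    Γ.circle b s = Γ.circle b t ∨ Γ.Touches b d s ∧ Γ.Touches b d t := by
  refine rel_of_circle_eq (r := fun s t => Γ.circle b s = Γ.circle b t ∨
    Γ.Touches b d s ∧ Γ.Touches b d t) ⟨fun _ => .inl rfl, ?_, ?_⟩ ?_ hst
  · rintro s t (h | h)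
    exacts [.inl h.symm, .inr h.symm]
  · rintro s t r (h | h) (h' | h')
    · exact .inl (h.trans h')
    · exact .inr ⟨(touches_congr h).2 h'.1, h'.2⟩
    · exact .inr ⟨h.1, (touches_congr h').1 h.2⟩
    · exact .inr ⟨h.1, h'.2⟩
  · rintro s t (⟨d'⟩ | ⟨d', β⟩)
    · exact .inl (Γ.circle_corner b d')
    · change Γ.circle b (d', β) = Γ.circle b (Γ.across a (d', β)) ∨
        Γ.Touches b d (d', β) ∧ Γ.Touches b d (Γ.across a (d', β))
      by_cases h₁ : d' = d
      · subst h₁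
        refine .inr ⟨touches_self .., ?_⟩
        rw [across_self_of_differsAt h.symm, touches_congr (circle_across ..)]
        exact touches_self ..
      by_cases h₂ : Γ.opp d' = d
      · subst h₂
        refine .inr ⟨?_, touches_self ..⟩
        rw [← touches_congr (Γ.circle_across b _)]
        exact touches_self ..
      · rw [← across_eq_of_differsAt h h₁ h₂, circle_across]
        exact .inl rfl

lemma touches_iff {Γ : RibbonGraph G D} {a b : Γ.State} {d : D} (h : Γ.DiffersAt a b d)
    (s : D × Bool) : Γ.Touches a d s ↔ Γ.Touches b d s := by
  suffices ∀ {a b : Γ.State}, Γ.DiffersAt a b d → Γ.Touches a d s → Γ.Touches b d s from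
    ⟨this h, this h.symm⟩
  rintro a b h (hs | hs) <;>
  · obtain h' | h' := circle_eq_or_touches h hs
    · exact (touches_congr h').2 (touches_self ..)
    · exact h'.1

lemma circle_eq_iff {Γ : RibbonGraph G D} {a b : Γ.State} {d : D} (h : Γ.DiffersAt a b d)
    {s t : D × Bool} (ht : ¬ Γ.Touches a d t) :
    Γ.circle a s = Γ.circle a t ↔ Γ.circle b s = Γ.circle b t := by
  refine ⟨fun hs => (circle_eq_or_touches h hs).resolve_right fun h' => ?_,
    fun hs => (circle_eq_or_touches h.symm hs).resolve_right fun h' => ht h'.2⟩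
  exact ht ((touches_iff h t).2 h'.2)

/-- If two different circles run along a half-edge, then changing its smoothing merges them. -/
lemma circle_eq_of_circle_ne [Finite D] {Γ : RibbonGraph G D} {a b : Γ.State} {d : D}
    (h : Γ.DiffersAt a b d) (hne : Γ.circle a (d, false) ≠ Γ.circle a (d, true)) :
    Γ.circle b (d, false) = Γ.circle b (d, true) := by
  classical
  by_contra hb
  have := Fintype.ofFinite D
  -- A parity argument: if the circles do not merge, then `around` pairs off the strands of `T`,
  -- while `across` pairs off all of them except `(d, false)`.
  let T : Finset (D × Bool) := Finset.univ.filter fun s =>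
    Γ.circle a s = Γ.circle a (d, false) ∧ Γ.circle b s = Γ.circle b (d, false)
  have mem_T (s) : s ∈ T ↔
      Γ.circle a s = Γ.circle a (d, false) ∧ Γ.circle b s = Γ.circle b (d, false) := by simp [T]
  have h_self : (d, false) ∈ T := by simp [mem_T]
  have h_even : ∑ s ∈ T, (1 : ZMod 2) = 0 :=
    Finset.sum_involution (fun s _ => Γ.around s) (fun _ _ => by decide)
      (fun s _ _ => Γ.around_ne s)
      (fun s hs => by simpa only [mem_T, circle_around] using hs) (fun s _ => Γ.around_around s)
  have h_rest (s) (hs : s ∈ T.erase (d, false)) : s.1 ≠ d ∧ Γ.opp s.1 ≠ d := by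
    obtain ⟨d', β⟩ := s
    rw [Finset.mem_erase, mem_T] at hs
    obtain ⟨hs₀, hsa, hsb⟩ := hs
    constructor
    · rintro rfl
      cases β
      · exact hs₀ rfl
      · exact hne hsa.symm
    -- A strand on the other half is joined to one of the two strands of `d` in `a` and to the other
    -- one in `b`; in one of the two states this is `(d, true)`, which is on a different circle from
    -- `(d, false)`.
    · intro hd
      have hA : (Γ.across a (d', β)).1 = d := hd
      obtain ⟨γ, hγ⟩ : ∃ γ, Γ.across a (d', β) = (d, γ) := ⟨_, Prod.ext hA rfl⟩
      have hγ' : (d', β) = Γ.across b (d, !γ) := by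
        rw [across_self_of_differsAt h, Bool.not_not, ← hγ, across_across]
      rw [← circle_across, hγ] at hsa
      rw [hγ', circle_across] at hsb
      cases γ
      · exact hb hsb.symm
      · exact hne hsa.symm
  have h_odd : ∑ s ∈ T.erase (d, false), (1 : ZMod 2) = 0 := by
    refine Finset.sum_involution (fun s _ => Γ.across a s) (fun _ _ => by decide)
      (fun s _ _ => Γ.across_ne a s) (fun s hs => ?_) (fun s _ => Γ.across_across a s)
    have hs' := h_rest s hs
    rw [Finset.mem_erase, mem_T] at hs ⊢
    refine ⟨fun heq => hs'.2 (congrArg Prod.fst heq), ?_, ?_⟩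
    · rw [circle_across, hs.2.1]
    · rw [← across_eq_of_differsAt h hs'.1 hs'.2, circle_across, hs.2.2]
  rw [← Finset.add_sum_erase _ _ h_self, h_odd] at h_even
  exact absurd h_even (by decide)

/-! ### Colorings of strands and the filtered maps for two colors -/

/-- The value at `x` of the character of `ℂ[x] / (x ^ 2 - 1)` given by a color. -/
def colorSign (c : ZMod 2) : ℂ := if c = 0 then 1 else -1

@[simp] lemma colorSign_zero : colorSign 0 = 1 := by simp [colorSign]

lemma colorSign_ne_zero (c : ZMod 2) : colorSign c ≠ 0 := by
  unfold colorSign; split_ifs <;> simp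

lemma colorSign_mul_self (c : ZMod 2) : colorSign c * colorSign c = 1 := by
  unfold colorSign; split_ifs <;> simp

lemma colorSign_injective : Function.Injective colorSign := by
  have h (c : ZMod 2) : c = 0 ∨ c = 1 := by revert c; decide
  intro c c'
  obtain rfl | rfl := h c <;> obtain rfl | rfl := h c' <;> simp [colorSign] <;> norm_num

lemma colorSign_add (c c' : ZMod 2) : colorSign (c + c') = colorSign c * colorSign c' := by
  have h (c : ZMod 2) : c = 0 ∨ c = 1 := by revert c; decide
  have h' : (1 + 1 : ZMod 2) = 0 := by decide
  obtain rfl | rfl := h c <;> obtain rfl | rfl := h c' <;> simp [colorSign, h']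

open scoped Classical in
/-- Multiplication by `x` at the circle through the strand `s` acts on `v` by the sign of the
color `f s`, for all strands `s`. -/
def IsColored {Γ : RibbonGraph G D} (a : Γ.State) (f : D × Bool → ZMod 2)
    (v : Γ.Monomial 2 a → ℂ) : Prop :=
  ∀ s I, v (I + Pi.single (Γ.circle a s) 1) = colorSign (f s) * v I

/-- The color is the eigenvalue of x at a circle, and a non-zero vector has only one eigenvalue
there. -/
lemma IsColored.eq_of_ne_zero {Γ : RibbonGraph G D} {a : Γ.State} {f : D × Bool → ZMod 2}
    {v : Γ.Monomial 2 a → ℂ} (hv : IsColored a f v) (h0 : v ≠ 0) {s t : D × Bool}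
    (hst : Γ.circle a s = Γ.circle a t) : f s = f t := by
  obtain ⟨I, hI⟩ := Function.ne_iff.1 h0
  have h := hv s I
  rw [hst, hv t I] at h
  exact (colorSign_injective (mul_right_cancel₀ hI h)).symm

open scoped Classical in
/-- The half-edge maps commute with multiplication by `x` at a strand. -/
lemma halfEdgeMap_add_single [Finite D] {Γ : RibbonGraph G D} {a b : Γ.State} {d : D}
    (h : Γ.DiffersAt a b d) (s : D × Bool) (J : Γ.Monomial 2 b) (I : Γ.Monomial 2 a) :
    Γ.halfEdgeMap 2 d a b (J + Pi.single (Γ.circle b s) 1) (I + Pi.single (Γ.circle a s) 1) =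
      Γ.halfEdgeMap 2 d a b J I := by
  have h_off : (∀ t, Γ.circle a t ≠ Γ.circle a (d, false) → Γ.circle a t ≠ Γ.circle a (d, true) →
      (J + Pi.single (Γ.circle b s) 1 : Γ.Monomial 2 b) (Γ.circle b t) =
        (I + Pi.single (Γ.circle a s) 1 : Γ.Monomial 2 a) (Γ.circle a t)) ↔
      ∀ t, Γ.circle a t ≠ Γ.circle a (d, false) → Γ.circle a t ≠ Γ.circle a (d, true) →
        J (Γ.circle b t) = I (Γ.circle a t) := by
    refine forall_congr' fun t => forall₂_congr fun h₁ h₂ => ?_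
    have ht : ¬ Γ.Touches a d t := fun h' => h'.elim h₁ h₂
    have := circle_eq_iff h (s := t) (t := s)
    simp only [Pi.add_apply, Pi.single_apply]
    rw [eq_comm (a := Γ.circle b t), eq_comm (a := Γ.circle a t), circle_eq_iff h ht]
    exact add_left_inj _
  have hT := touches_iff h s
  unfold Touches at hT
  simp only [halfEdgeMap, Matrix.of_apply, h_off]
  congr 1
  by_cases ha : Γ.circle a (d, false) = Γ.circle a (d, true)
  · by_cases hb : Γ.circle b (d, false) = Γ.circle b (d, true)
    · simp only [ha, hb, or_self] at hT
      simp only [ha, hb, ne_eq, not_true_eq_false, if_false, Pi.add_apply, Pi.single_apply,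
        eq_comm (b := Γ.circle a s), eq_comm (b := Γ.circle b s), hT]
      simp only [add_right_comm (I _), add_left_inj]
    · simp only [ha, or_self] at hT
      simp only [ha, hb, ne_eq, not_true_eq_false, not_false_eq_true, if_false, if_true,
        Pi.add_apply, Pi.single_apply]
      rw [add_add_add_comm, add_right_comm (I _)]
      -- The two new circles are different, so a strand on the old circle raises the exponent of
      -- exactly one of them.
      have : (if Γ.circle b (d, false) = Γ.circle b s then (1 : ZMod 2) else 0) +
          (if Γ.circle b (d, true) = Γ.circle b s then 1 else 0) =
          if Γ.circle a (d, true) = Γ.circle a s then 1 else 0 := by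
        rw [eq_comm (b := Γ.circle a s), eq_comm (b := Γ.circle b s), eq_comm (b := Γ.circle b s),
          hT]
        by_cases h₁ : Γ.circle b s = Γ.circle b (d, false)
        · simp [h₁, hb]
        · simp [h₁]
      simp only [this, add_left_inj]
  · have hb := circle_eq_of_circle_ne h ha
    simp only [hb, or_self] at hT
    simp only [ha, hb, ne_eq, not_false_eq_true, if_true, Pi.add_apply, Pi.single_apply]
    rw [add_add_add_comm]
    have : (if Γ.circle a (d, false) = Γ.circle a s then (1 : ZMod 2) else 0) +
        (if Γ.circle a (d, true) = Γ.circle a s then 1 else 0) =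
        if Γ.circle b (d, true) = Γ.circle b s then 1 else 0 := by
      rw [eq_comm (b := Γ.circle b s), eq_comm (b := Γ.circle a s), eq_comm (b := Γ.circle a s),
        ← hT]
      by_cases h₁ : Γ.circle a s = Γ.circle a (d, false)
      · simp [h₁, ha]
      · simp [h₁]
    simp only [this, add_left_inj]

lemma IsColored.mulVec [Finite D] {Γ : RibbonGraph G D} {a b : Γ.State} {d : D}
    [Fintype (Γ.Monomial 2 a)] (h : Γ.DiffersAt a b d) {f : D × Bool → ZMod 2}
    {v : Γ.Monomial 2 a → ℂ} (hv : IsColored a f v) :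
    IsColored b f ((Γ.halfEdgeMap 2 d a b).mulVec v) := by
  classical
  intro s J
  simp only [Matrix.mulVec, dotProduct]
  rw [← Equiv.sum_comp (Equiv.addRight (Pi.single (Γ.circle a s) 1)), Finset.mul_sum]
  refine Finset.sum_congr rfl fun I _ => ?_
  rw [Equiv.coe_addRight, halfEdgeMap_add_single h, hv s I]
  ring

/-- Either the two strands of `d` are on one circle in `a`, or they are in `b` after merging. A
non-zero vector cannot give this circle two colors, so the source or the image vanishes. -/
lemma IsColored.mulVec_eq_zero [Finite D] {Γ : RibbonGraph G D} {a b : Γ.State} {d : D}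
    [Fintype (Γ.Monomial 2 a)] (h : Γ.DiffersAt a b d) {f : D × Bool → ZMod 2}
    {v : Γ.Monomial 2 a → ℂ} (hv : IsColored a f v) (hf : f (d, false) ≠ f (d, true)) :
    (Γ.halfEdgeMap 2 d a b).mulVec v = 0 := by
  by_contra h0
  have hv0 : v ≠ 0 := by
    rintro rfl
    exact h0 (Matrix.mulVec_zero _)
  have hne : Γ.circle a (d, false) ≠ Γ.circle a (d, true) := fun h' => hf (hv.eq_of_ne_zero hv0 h')
  exact hf ((hv.mulVec h).eq_of_ne_zero h0 (circle_eq_of_circle_ne h hne))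

lemma monomial_ext {Γ : RibbonGraph G D} {a : Γ.State} {n : ℕ} {I I' : Γ.Monomial n a}
    (h : ∀ s, I (Γ.circle a s) = I' (Γ.circle a s)) : I = I' :=
  funext fun c => Quotient.inductionOn c h

/-- Non-negative entries rule out cancellation once all contributions have the same phase. -/
lemma exists_halfEdgeMap_eq_ofReal (Γ : RibbonGraph G D) (n : ℕ) (d : D) (a b : Γ.State)
    (J : Γ.Monomial n b) (I : Γ.Monomial n a) :
    ∃ r : ℝ, 0 ≤ r ∧ Γ.halfEdgeMap n d a b J I = r := by
  simp only [halfEdgeMap, Matrix.of_apply]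
  split_ifs
  exacts [⟨1, by simp⟩, ⟨0, by simp⟩, ⟨1, by simp⟩, ⟨0, by simp⟩, ⟨_, Real.sqrt_nonneg _, rfl⟩,
    ⟨0, by simp⟩, ⟨0, by simp⟩]

/-- The monomials contributing to the coefficient of `1` under a half-edge map all contribute
with the same phase, and there is one of them. -/
lemma IsColored.exists_phase {Γ : RibbonGraph G D} {a b : Γ.State}
    {d : D} {f : D × Bool → ZMod 2} {v : Γ.Monomial 2 a → ℂ}
    (hv : IsColored a f v) (hf : f (d, false) = f (d, true)) :
    ∃ z : ℂ, z ≠ 0 ∧ (∃ I, Γ.halfEdgeMap 2 d a b 0 I ≠ 0) ∧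
      ∀ I, Γ.halfEdgeMap 2 d a b 0 I ≠ 0 → v I = z * v 0 := by
  classical
  have h01 (c : ZMod 2) : c = 0 ∨ c = 1 := by revert c; decide
  have h11 : (1 + 1 : ZMod 2) = 0 := by decide
  have h20 : ((2 * (2 / 2) : ℕ) : ZMod 2) = 0 := by decide
  have h21 : ((2 / 2 : ℕ) : ZMod 2) = 1 := by decide
  have hv₁ := hv (d, true) 0
  rw [zero_add] at hv₁
  by_cases ha : Γ.circle a (d, false) = Γ.circle a (d, true)
  · by_cases hb : Γ.circle b (d, false) = Γ.circle b (d, true)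
    -- The exponent is shifted by m = 1, so only x on the affected circle is sent to 1; this costs
    -- one eigenvalue. In a split the shift 2m vanishes modulo two and only 1 contributes.
    · refine ⟨colorSign (f (d, true)), colorSign_ne_zero _,
        ⟨Pi.single (Γ.circle a (d, true)) 1, ?_⟩, fun I hI => ?_⟩
      · simp only [halfEdgeMap, Matrix.of_apply, ha, hb, h21]
        rw [if_pos fun s hs _ => by simp [hs]]
        simp [h11]
      · simp only [halfEdgeMap, Matrix.of_apply, ha, hb, h21, ne_eq, ite_eq_right_iff,
          Classical.not_imp, not_true_eq_false, if_false] at hI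
        obtain ⟨hI, hI', -⟩ := hI
        rw [← hv₁]
        congr 1
        refine monomial_ext fun s => ?_
        by_cases hs : Γ.circle a s = Γ.circle a (d, true)
        · rw [hs, Pi.single_eq_same]
          refine (h01 _).resolve_left fun h' => ?_
          simp [h'] at hI'
        · rw [← hI s hs hs, Pi.single_eq_of_ne hs, Pi.zero_apply]
    · refine ⟨1, one_ne_zero, ⟨0, ?_⟩, fun I hI => ?_⟩
      · simp only [halfEdgeMap, Matrix.of_apply, ha, h20]
        simp [hb]
      · simp only [halfEdgeMap, Matrix.of_apply, ha, hb, h20, ne_eq, ite_eq_right_iff,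
          Classical.not_imp, not_true_eq_false, if_false, not_false_eq_true, if_true] at hI
        obtain ⟨hI, hI', -⟩ := hI
        rw [one_mul]
        congr 1
        refine monomial_ext fun s => ?_
        by_cases hs : Γ.circle a s = Γ.circle a (d, true)
        · simpa [hs] using hI'.symm
        · exact (hI s hs hs).symm
  · refine ⟨1, one_ne_zero, ⟨0, ?_⟩, fun I hI => ?_⟩
    · simp [halfEdgeMap, ha]
    · simp only [halfEdgeMap, Matrix.of_apply, ha, ne_eq, ite_eq_right_iff,
        Classical.not_imp, not_false_eq_true, if_true] at hI
      obtain ⟨hI, hI', -⟩ := hI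
      rw [one_mul]
      obtain h₁ | h₁ := h01 (I (Γ.circle a (d, true)))
      · congr 1
        refine monomial_ext fun s => ?_
        by_cases hs : Γ.circle a s = Γ.circle a (d, true)
        · rw [hs, h₁, Pi.zero_apply]
        by_cases hs' : Γ.circle a s = Γ.circle a (d, false)
        · rw [h₁] at hI'
          simpa [hs'] using hI'.symm
        · exact (hI s hs' hs).symm
      -- Besides 1 ⊗ 1, the monomial x ⊗ x merges to 1. Its phase is the product of two equal signs,
      -- hence 1.
      · have hv₂ := hv (d, false) (Pi.single (Γ.circle a (d, true)) 1)
        rw [hv₁, hf, ← mul_assoc, colorSign_mul_self, one_mul] at hv₂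
        rw [← hv₂]
        congr 1
        refine monomial_ext fun s => ?_
        rw [Pi.add_apply]
        by_cases hs : Γ.circle a s = Γ.circle a (d, true)
        · rw [hs, h₁, Pi.single_eq_same, Pi.single_eq_of_ne (Ne.symm ha), add_zero]
        by_cases hs' : Γ.circle a s = Γ.circle a (d, false)
        · rw [hs', Pi.single_eq_same, Pi.single_eq_of_ne ha, zero_add]
          refine (h01 _).resolve_left fun h' => ?_
          simp [h', h₁] at hI'
        · rw [Pi.single_eq_of_ne hs, Pi.single_eq_of_ne hs', ← hI s hs' hs, add_zero, Pi.zero_apply]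

lemma IsColored.mulVec_apply_zero_ne_zero {Γ : RibbonGraph G D} {a b : Γ.State} {d : D}
    [Fintype (Γ.Monomial 2 a)] {f : D × Bool → ZMod 2} {v : Γ.Monomial 2 a → ℂ}
    (hv : IsColored a f v) (h0 : v 0 ≠ 0) (hf : f (d, false) = f (d, true)) :
    (Γ.halfEdgeMap 2 d a b).mulVec v 0 ≠ 0 := by
  obtain ⟨z, hz, ⟨I, hI⟩, h⟩ := hv.exists_phase (b := b) hf
  choose r hr hr' using exists_halfEdgeMap_eq_ofReal Γ 2 d a b 0
  have : (Γ.halfEdgeMap 2 d a b).mulVec v 0 = ((∑ I, r I : ℝ) : ℂ) * (z * v 0) := by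
    rw [Complex.ofReal_sum, Finset.sum_mul]
    refine Finset.sum_congr rfl fun I _ => ?_
    change Γ.halfEdgeMap 2 d a b 0 I * v I = _
    rw [← hr']
    by_cases hI : Γ.halfEdgeMap 2 d a b 0 I = 0
    · rw [hI, zero_mul, zero_mul]
    · rw [h I hI]
  rw [this]
  refine mul_ne_zero (Complex.ofReal_ne_zero.2 (ne_of_gt ?_)) (mul_ne_zero hz h0)
  refine Finset.sum_pos' (fun I _ => hr I) ⟨I, Finset.mem_univ _, (hr I).lt_of_ne' fun h' => hI ?_⟩
  rw [hr', h', Complex.ofReal_zero]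

/-! ### The basis of colorings -/

/-- The character of the group of exponents given by a coloring `g`; as a function of the exponents
these are the idempotents of `(ℂ[x] / (x ^ 2 - 1)) ^ ⊗ k` up to scalars. -/
def coloringCharacter {X : Type*} [Fintype X] (g : X → ZMod 2) :
    Multiplicative (X → ZMod 2) →* ℂ where
  toFun I := ∏ c, colorSign (g c * I.toAdd c)
  map_one' := by simp
  map_mul' I J := by simp [mul_add, colorSign_add, Finset.prod_mul_distrib]

lemma coloringCharacter_single {X : Type*} [Fintype X] [DecidableEq X] (g : X → ZMod 2) (c : X) :
    coloringCharacter g (.ofAdd (Pi.single c 1)) = colorSign (g c) := by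
  simp only [coloringCharacter, MonoidHom.coe_mk, OneHom.coe_mk, toAdd_ofAdd]
  rw [Fintype.prod_eq_single c fun c' hc' => by simp [Pi.single_eq_of_ne hc']]
  simp

lemma coloringCharacter_injective {X : Type*} [Fintype X] :
    Function.Injective (coloringCharacter (X := X)) := by
  classical
  intro g g' h
  funext c
  apply colorSign_injective
  rw [← coloringCharacter_single, h, coloringCharacter_single]

/-- Dedekind's independence of characters. -/
lemma linearIndependent_coloringCharacter (X : Type*) [Fintype X] :
    LinearIndependent ℂ fun (g : X → ZMod 2) (I : X → ZMod 2) =>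
      coloringCharacter g (.ofAdd I) :=
  (linearIndependent_monoidHom (Multiplicative (X → ZMod 2)) ℂ).comp _ coloringCharacter_injective

instance (Γ : RibbonGraph G D) (a : Γ.State) [Finite D] : Fintype (Γ.Circle a) :=
  Fintype.ofFinite _

/-- The vector of the coloring `g` of the circles. -/
def coloringVector {Γ : RibbonGraph G D} {a : Γ.State} [Finite D] (g : Γ.Circle a → ZMod 2) :
    Γ.Monomial 2 a → ℂ :=
  fun I => coloringCharacter g (.ofAdd I)

@[simp] lemma coloringVector_zero {Γ : RibbonGraph G D} {a : Γ.State} [Finite D]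
    (g : Γ.Circle a → ZMod 2) : coloringVector g 0 = 1 :=
  map_one (coloringCharacter g)

lemma isColored_coloringVector {Γ : RibbonGraph G D} {a : Γ.State} [Finite D]
    (g : Γ.Circle a → ZMod 2) : IsColored a (fun s => g (Γ.circle a s)) (coloringVector g) := by
  classical
  intro s I
  rw [coloringVector, ofAdd_add, map_mul, coloringCharacter_single, mul_comm]
  rfl

/-- Common eigenspaces are lines: every monomial is reached from 1 by multiplying by x at circles,
so the value at 0 determines the vector. -/
lemma IsColored.eq_smul_coloringVector {Γ : RibbonGraph G D} {a : Γ.State} [Finite D]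
    {g : Γ.Circle a → ZMod 2} {v : Γ.Monomial 2 a → ℂ}
    (hv : IsColored a (fun s => g (Γ.circle a s)) v) : v = v 0 • coloringVector g := by
  classical
  have h01 (c : ZMod 2) : c = 0 ∨ c = 1 := by revert c; decide
  funext I
  rw [← Finset.univ_sum_single I]
  induction (Finset.univ : Finset (Γ.Circle a)) using Finset.induction_on with
  | empty => simp
  | insert c S hc ih =>
    rw [Finset.sum_insert hc, add_comm]
    obtain h | h := h01 (I c)
    · rw [h, Pi.single_zero, add_zero, ih]
    · obtain ⟨s, rfl⟩ : ∃ s, Γ.circle a s = c := Quotient.exists_rep c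
      rw [h, hv, Pi.smul_apply, isColored_coloringVector, ih, Pi.smul_apply, smul_eq_mul,
        smul_eq_mul]
      ring

/-- The coloring vectors form a basis. -/
def coloringBasis [Finite D] (Γ : RibbonGraph G D) (a : Γ.State) :
    Module.Basis (Γ.Circle a → ZMod 2) ℂ (Γ.Monomial 2 a → ℂ) :=
  haveI : Nonempty (Γ.Circle a → ZMod 2) := ⟨0⟩
  letI : DecidableEq (Γ.Circle a) := Classical.decEq _
  basisOfLinearIndependentOfCardEqFinrank
    (b := coloringVector) (linearIndependent_coloringCharacter (Γ.Circle a))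
    (Module.finrank_fintype_fun_eq_card ℂ).symm

@[simp] lemma coloringBasis_apply [Finite D] (Γ : RibbonGraph G D) (a : Γ.State)
    (g : Γ.Circle a → ZMod 2) : Γ.coloringBasis a g = coloringVector g := by
  let : DecidableEq (Γ.Circle a) := Classical.decEq _
  exact congrFun (coe_basisOfLinearIndependentOfCardEqFinrank _ _) g

/-! ### The local map at a vertex -/

lemma differsAt_update {Γ : RibbonGraph G D} [DecidableEq D] {a : Γ.State} {d : D}
    (h : a d = false) : Γ.DiffersAt a (Function.update a d true) d :=
  ⟨by simp [h], fun _ hd' => Function.update_of_ne hd' _ _⟩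

lemma PathChoice.vert_eq {Γ : RibbonGraph G D} (p : Γ.PathChoice) (x : V(G)) (i : Fin 3) :
    Γ.vert (p x i) = x :=
  (p x i).2

lemma PathChoice.exists_eq {Γ : RibbonGraph G D} (p : Γ.PathChoice) {x : V(G)} {d : D}
    (hd : Γ.vert d = x) : ∃ i, (p x i : D) = d :=
  ⟨(p x).symm ⟨d, hd⟩, by simp⟩

lemma PathChoice.coe_injective {Γ : RibbonGraph G D} (p : Γ.PathChoice) (x : V(G)) :
    Function.Injective fun i => (p x i : D) :=
  Subtype.val_injective.comp (p x).injective

section VertexMap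

variable [Finite D] {Γ : RibbonGraph G D} (p : Γ.PathChoice) (x : V(G)) {ν' : Finset V}

/-- The local map at a vertex is a composition of maps of half-edges between states that lead from
the `0`-smoothing of the vertex to its `1`-smoothing. -/
lemma exists_vertexMap_mulVec_eq {ν : Finset V} [Fintype (Γ.Monomial 2 (Γ.vertexState ν))]
    (hx : (x : V) ∉ ν) (hν' : ∀ y, y ∈ ν' ↔ y = x ∨ y ∈ ν) :
    ∃ (a₁ a₂ : Γ.State) (_ : Fintype (Γ.Monomial 2 a₁)) (_ : Fintype (Γ.Monomial 2 a₂)),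
      Γ.DiffersAt (Γ.vertexState ν) a₁ (p x 0) ∧ Γ.DiffersAt a₁ a₂ (p x 1) ∧
      Γ.DiffersAt a₂ (Γ.vertexState ν') (p x 2) ∧ ∀ v, (Γ.vertexMap p 2 x ν ν').mulVec v =
        (Γ.halfEdgeMap 2 (p x 2) a₂ (Γ.vertexState ν')).mulVec
          ((Γ.halfEdgeMap 2 (p x 1) a₁ a₂).mulVec
            ((Γ.halfEdgeMap 2 (p x 0) (Γ.vertexState ν) a₁).mulVec v)) := by
  let _ : DecidableEq D := fun _ _ => Classical.propDecidable _
  have hne (i j : Fin 3) (hij : i ≠ j) : (p x i : D) ≠ p x j := fun h => hij (p.coe_injective x h)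
  have h0 (i) : Γ.vertexState ν (p x i) = false := by simp [vertexState, p.vert_eq, hx]
  have h1 (i) : Γ.vertexState ν' (p x i) = true := by simp [vertexState, p.vert_eq, hν']
  refine ⟨Function.update (Γ.vertexState ν) (p x 0) true,
    Function.update (Function.update (Γ.vertexState ν) (p x 0) true) (p x 1) true,
    Fintype.ofFinite _, Fintype.ofFinite _, differsAt_update (h0 _), differsAt_update ?_,
    ⟨?_, fun d hd => ?_⟩, fun v => ?_⟩
  · rw [Function.update_of_ne (hne 1 0 (by decide)), h0]
  · rw [Function.update_of_ne (hne 2 1 (by decide)), Function.update_of_ne (hne 2 0 (by decide)),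
      h0, h1]
    rfl
  · by_cases hdx : Γ.vert d = x
    · obtain ⟨i, rfl⟩ := p.exists_eq hdx
      obtain rfl | rfl : i = 0 ∨ i = 1 := by
        have : i ≠ 2 := fun h => hd (by rw [h])
        omega
      · rw [h1, Function.update_of_ne (hne _ _ (by decide)), Function.update_self]
      · rw [h1, Function.update_self]
    · have hdp (i) : d ≠ p x i := fun h => hdx (h ▸ p.vert_eq x i)
      rw [Function.update_of_ne (hdp 1), Function.update_of_ne (hdp 0)]
      simp [vertexState, hν', hdx]
  · let _ : Fintype (Γ.Monomial 2 (Function.update (Γ.vertexState ν) (p x 0) true)) :=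
      Fintype.ofFinite _
    let _ : Fintype (Γ.Monomial 2
        (Function.update (Function.update (Γ.vertexState ν) (p x 0) true) (p x 1) true)) :=
      Fintype.ofFinite _
    rw [Matrix.mulVec_mulVec, Matrix.mulVec_mulVec]
    rfl

variable {ν : Finset V} [Fintype (Γ.Monomial 2 (Γ.vertexState ν))] {f : D × Bool → ZMod 2}
  {v : Γ.Monomial 2 (Γ.vertexState ν) → ℂ}

lemma IsColored.vertexMap_mulVec (hx : (x : V) ∉ ν) (hν' : ∀ y, y ∈ ν' ↔ y = x ∨ y ∈ ν)
    (hv : IsColored (Γ.vertexState ν) f v) :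
    IsColored (Γ.vertexState ν') f ((Γ.vertexMap p 2 x ν ν').mulVec v) := by
  obtain ⟨a₁, a₂, _, _, h₀, h₁, h₂, h⟩ := exists_vertexMap_mulVec_eq p x hx hν'
  rw [h]
  exact ((hv.mulVec h₀).mulVec h₁).mulVec h₂

/-- Intermediate vectors keep the coloring `f` of the strands, so the factor belonging to the
bicolored half-edge kills, wherever it stands in the chosen order. -/
lemma IsColored.vertexMap_mulVec_eq_zero (hx : (x : V) ∉ ν)
    (hν' : ∀ y, y ∈ ν' ↔ y = x ∨ y ∈ ν) (hv : IsColored (Γ.vertexState ν) f v)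
    (hf : ∃ d, Γ.vert d = x ∧ f (d, false) ≠ f (d, true)) :
    (Γ.vertexMap p 2 x ν ν').mulVec v = 0 := by
  obtain ⟨a₁, a₂, _, _, h₀, h₁, h₂, h⟩ := exists_vertexMap_mulVec_eq p x hx hν'
  obtain ⟨d, hd, hfd⟩ := hf
  obtain ⟨i, rfl⟩ := p.exists_eq hd
  rw [h]
  obtain rfl | rfl | rfl : i = 0 ∨ i = 1 ∨ i = 2 := by omega
  · rw [hv.mulVec_eq_zero h₀ hfd, Matrix.mulVec_zero, Matrix.mulVec_zero]
  · rw [(hv.mulVec h₀).mulVec_eq_zero h₁ hfd, Matrix.mulVec_zero]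
  · exact ((hv.mulVec h₀).mulVec h₁).mulVec_eq_zero h₂ hfd

lemma IsColored.vertexMap_mulVec_apply_zero_ne_zero (hx : (x : V) ∉ ν)
    (hν' : ∀ y, y ∈ ν' ↔ y = x ∨ y ∈ ν) (hv : IsColored (Γ.vertexState ν) f v) (h0 : v 0 ≠ 0)
    (hf : ∀ d, Γ.vert d = x → f (d, false) = f (d, true)) :
    (Γ.vertexMap p 2 x ν ν').mulVec v 0 ≠ 0 := by
  obtain ⟨a₁, a₂, _, _, h₀, h₁, h₂, h⟩ := exists_vertexMap_mulVec_eq p x hx hν'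
  rw [h]
  exact ((hv.mulVec h₀).mulVec h₁).mulVec_apply_zero_ne_zero
    ((hv.mulVec h₀).mulVec_apply_zero_ne_zero
      (hv.mulVec_apply_zero_ne_zero h0 (hf _ (p.vert_eq x 0))) (hf _ (p.vert_eq x 1)))
    (hf _ (p.vert_eq x 2))

/-- The local map at a vertex is injective on the colorings that are constant along its half-edges,
up to non-zero scalars. -/
lemma linearIndependent_vertexMap_mulVec (hx : (x : V) ∉ ν)
    (hν' : ∀ y, y ∈ ν' ↔ y = x ∨ y ∈ ν) :
    LinearIndependent ℂ fun g : {g : Γ.Circle (Γ.vertexState ν) → ZMod 2 //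
      ∀ d, Γ.vert d = x → g (Γ.circle _ (d, false)) = g (Γ.circle _ (d, true))} =>
        (Γ.vertexMap p 2 x ν ν').mulVec (coloringVector g.1) := by
  have hcol (g : Γ.Circle (Γ.vertexState ν) → ZMod 2) :=
    (isColored_coloringVector g).vertexMap_mulVec p x hx hν'
  have hne (g : {g : Γ.Circle (Γ.vertexState ν) → ZMod 2 //
      ∀ d, Γ.vert d = x → g (Γ.circle _ (d, false)) = g (Γ.circle _ (d, true))}) :=
    (isColored_coloringVector g.1).vertexMap_mulVec_apply_zero_ne_zero p x hx hν'
      (by simp) g.2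
  -- The image is non-zero, so the strand colors of `g` are constant on the new circles and descend
  -- to a coloring of them.
  have hex (g : {g : Γ.Circle (Γ.vertexState ν) → ZMod 2 //
      ∀ d, Γ.vert d = x → g (Γ.circle _ (d, false)) = g (Γ.circle _ (d, true))}) :
      ∃ g' : Γ.Circle (Γ.vertexState ν') → ZMod 2, ∀ s, g' (Γ.circle _ s) = g.1 (Γ.circle _ s) := by
    have hg (s t) (hst : Γ.circle (Γ.vertexState ν') s = Γ.circle (Γ.vertexState ν') t) :
        g.1 (Γ.circle _ s) = g.1 (Γ.circle _ t) :=
      (hcol g.1).eq_of_ne_zero (fun h => hne g (congrFun h 0)) hst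
    exact ⟨Quotient.lift (fun s => g.1 (Γ.circle _ s)) fun s t hst => hg s t (Quotient.sound hst),
      fun s => rfl⟩
  choose G' hG' using hex
  have hinj : Function.Injective G' := fun g g' h => Subtype.ext <| funext fun c => by
    obtain ⟨s, rfl⟩ : ∃ s, Γ.circle _ s = c := Quotient.exists_rep c
    rw [← hG', h, hG']
  convert ((linearIndependent_coloringCharacter (Γ.Circle (Γ.vertexState ν'))).comp G' hinj
    ).units_smul (fun g => Units.mk0 _ (hne g)) using 2 with g
  refine IsColored.eq_smul_coloringVector (g := G' g) ?_
  simp only [hG']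
  exact hcol g.1

end VertexMap

/-! ### Half-edges and matchings -/

lemma edge_mem (Γ : RibbonGraph G D) (d : D) : Γ.edge d ∈ E(G) :=
  (Γ.isLink d).edge_mem

lemma vert_mem (Γ : RibbonGraph G D) (d : D) : Γ.vert d ∈ V(G) :=
  (Γ.isLink d).left_mem

lemma finite_edgeSet [Finite D] (Γ : RibbonGraph G D) : Finite E(G) :=
  Finite.of_surjective (fun d => (⟨Γ.edge d, Γ.edge_mem d⟩ : E(G))) fun e =>
    (Γ.exists_edge e e.2).imp fun _ hd => Subtype.ext hd

lemma vert_rot (Γ : RibbonGraph G D) (d : D) : Γ.vert (Γ.rot d) = Γ.vert d :=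
  (Γ.rot_sameCycle _ _).1 (Equiv.Perm.sameCycle_apply_left.2 (Equiv.Perm.SameCycle.refl _ _))

lemma exists_halfEdge_of_inc (Γ : RibbonGraph G D) {e : E} {x : V} (h : G.Inc e x) :
    ∃ d, Γ.edge d = e ∧ Γ.vert d = x := by
  obtain ⟨d, rfl⟩ := Γ.exists_edge e h.edge_mem
  obtain rfl | rfl := h.eq_or_eq_of_isLink (Γ.isLink d)
  · exact ⟨d, rfl, rfl⟩
  · exact ⟨Γ.opp d, Γ.edge_opp d, rfl⟩

/-- Counting half-edges instead of edges excludes loops automatically, since a loop has two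
half-edges at its vertex. -/
lemma isPerfectMatching_iff {Γ : RibbonGraph G D} (p : Γ.PathChoice) {M : Set E} :
    IsPerfectMatching G M ↔ M ⊆ E(G) ∧ ∀ x : V(G), ∃! i, Γ.edge (p x i) ∈ M := by
  constructor
  · rintro ⟨hM, h⟩
    refine ⟨fun e he => (hM e he).1, fun x => ?_⟩
    obtain ⟨e, ⟨he, hex⟩, huniq⟩ := h x x.2
    obtain ⟨d, rfl, hd⟩ := Γ.exists_halfEdge_of_inc hex
    obtain ⟨i, rfl⟩ := p.exists_eq hd
    refine ⟨i, he, fun j hj => ?_⟩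
    have hjx : G.Inc (Γ.edge (p x j)) x := ⟨_, by simpa only [p.vert_eq] using Γ.isLink (p x j)⟩
    obtain h' | h' := (Γ.edge_eq_iff _ _).1 (huniq _ ⟨hj, hjx⟩)
    · exact (p.coe_injective x h').symm
    · have := Γ.isLink (p x j)
      rw [← h', p.vert_eq, p.vert_eq] at this
      exact absurd this ((hM _ hj).2 x)
  · rintro ⟨hM, h⟩
    refine ⟨fun e he => ⟨hM he, fun x hx => ?_⟩, fun x hx => ?_⟩
    · obtain ⟨d, rfl⟩ := Γ.exists_edge e (hM he)
      obtain ⟨i, hi⟩ := p.exists_eq (x := ⟨x, hx.vertex_mem⟩) (hx.eq_of_inc (Γ.isLink d).inc_left).symm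
      obtain ⟨j, hj⟩ := p.exists_eq (x := ⟨x, hx.vertex_mem⟩) (hx.eq_of_inc (Γ.isLink d).inc_right).symm
      have hij : i = j := (h ⟨x, hx.vertex_mem⟩).unique (by rwa [hi]) (by rwa [hj, edge_opp])
      exact Γ.opp_ne d (by rw [← hj, ← hij, hi])
    · obtain ⟨i, hi, huniq⟩ := h ⟨x, hx⟩
      refine ⟨_, ⟨hi, _, by simpa only [p.vert_eq] using Γ.isLink (p ⟨x, hx⟩ i)⟩, ?_⟩
      rintro e ⟨he, hex⟩
      obtain ⟨d, rfl, hd⟩ := Γ.exists_halfEdge_of_inc hex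
      obtain ⟨j, rfl⟩ := p.exists_eq (x := ⟨x, hx⟩) hd
      rw [huniq j he]

/-! ### Cellular chains with coefficients in the field with two elements -/

/-- The difference of the colors on the two sides of a half-edge. -/
def sideDiff {Γ : RibbonGraph G D} (g : Γ.Face → ZMod 2) (d : D) : ZMod 2 :=
  g (Γ.circle _ (d, true)) + g (Γ.circle _ (d, false))

lemma sideDiff_eq_zero_iff {Γ : RibbonGraph G D} {g : Γ.Face → ZMod 2} {d : D} :
    sideDiff g d = 0 ↔ g (Γ.circle _ (d, false)) = g (Γ.circle _ (d, true)) := by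
  rw [sideDiff, CharTwo.add_eq_zero, eq_comm]

/-- Seen from the other end the two sides are kept or exchanged, depending on the sign of the edge;
their sum does not notice. -/
lemma sideDiff_opp {Γ : RibbonGraph G D} (g : Γ.Face → ZMod 2) (d : D) :
    sideDiff g (Γ.opp d) = sideDiff g d := by
  have h₁ := Γ.circle_across (fun _ => false) (d, true)
  have h₂ := Γ.circle_across (fun _ => false) (d, false)
  simp only [across] at h₁ h₂
  rw [sideDiff, sideDiff, ← h₁, ← h₂]
  cases Γ.twisted (Γ.edge d)
  · exact add_comm _ _
  · rfl

/-- The set of edges across which a coloring of the faces changes, as a linear map. -/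
def faceCoboundary (Γ : RibbonGraph G D) : (Γ.Face → ZMod 2) →ₗ[ZMod 2] (E(G) → ZMod 2) where
  toFun g e := sideDiff g (Γ.exists_edge e e.2).choose
  map_add' g g' := by
    funext e
    simp only [sideDiff, Pi.add_apply]
    ring
  map_smul' c g := by
    funext e
    simp only [sideDiff, Pi.smul_apply, smul_eq_mul, RingHom.id_apply]
    ring

lemma faceCoboundary_apply {Γ : RibbonGraph G D} (g : Γ.Face → ZMod 2) (d : D) :
    Γ.faceCoboundary g ⟨Γ.edge d, Γ.edge_mem d⟩ = sideDiff g d := by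
  obtain h | h := (Γ.edge_eq_iff _ _).1 (Γ.exists_edge _ (Γ.edge_mem d)).choose_spec.symm
  · exact congrArg (sideDiff g) h
  · exact (congrArg (sideDiff g) h).trans (sideDiff_opp g d)

/-- The boundary of edges. -/
def edgeBoundary {Γ : RibbonGraph G D} (p : Γ.PathChoice) :
    (E(G) → ZMod 2) →ₗ[ZMod 2] (V(G) → ZMod 2) where
  toFun u x := ∑ i, u ⟨Γ.edge (p x i), Γ.edge_mem _⟩
  map_add' u u' := by
    funext x
    simp [Finset.sum_add_distrib]
  map_smul' c u := by
    funext x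
    simp [Finset.mul_sum]

lemma edgeBoundary_apply {Γ : RibbonGraph G D} (p : Γ.PathChoice) (u : E(G) → ZMod 2) (x : V(G)) :
    edgeBoundary p u x = ∑ i, u ⟨Γ.edge (p x i), Γ.edge_mem _⟩ := rfl

/-- Each corner is counted twice: `rot` permutes the half-edges at `x` and matches the `true` side
of each with the `false` side of the next. -/
lemma sum_sideDiff {Γ : RibbonGraph G D} (p : Γ.PathChoice) (g : Γ.Face → ZMod 2) (x : V(G)) :
    ∑ i, sideDiff g (p x i) = 0 := by
  let σ : Fin 3 ≃ Fin 3 := ((p x).trans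
    (Γ.rot.subtypePerm (p := fun d => Γ.vert d = x) fun d => by rw [vert_rot])).trans (p x).symm
  have hσ (i) : (p x (σ i) : D) = Γ.rot (p x i) := by simp [σ]
  have : ∑ i, g (Γ.circle _ (p x i, true)) = ∑ i, g (Γ.circle _ (p x i, false)) := by
    rw [← Equiv.sum_comp σ fun i => g (Γ.circle _ (p x i, false))]
    exact Finset.sum_congr rfl fun i _ => by rw [circle_corner, hσ]
  simp only [sideDiff, Finset.sum_add_distrib, this]
  exact CharTwo.add_self_eq_zero _

lemma edgeBoundary_faceCoboundary {Γ : RibbonGraph G D} (p : Γ.PathChoice)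
    (g : Γ.Face → ZMod 2) : edgeBoundary p (Γ.faceCoboundary g) = 0 := by
  funext x
  simp only [edgeBoundary_apply, faceCoboundary_apply]
  exact sum_sideDiff p g x

open scoped Classical in
lemma sum_path_eq {Γ : RibbonGraph G D} (p : Γ.PathChoice) (x : V(G)) (d : D) :
    ∑ i, (if (p x i : D) = d then (1 : ZMod 2) else 0) = if Γ.vert d = x then 1 else 0 := by
  split_ifs with h
  · obtain ⟨j, rfl⟩ := p.exists_eq h
    simp [(p.coe_injective x).eq_iff]
  · refine Finset.sum_eq_zero fun i _ => if_neg ?_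
    rintro rfl
    exact h (p.vert_eq x i)

open scoped Classical in
lemma edgeBoundary_single {Γ : RibbonGraph G D} (p : Γ.PathChoice) {e : E} {y z : V}
    (h : G.IsLink e y z) : edgeBoundary p (Pi.single ⟨e, h.edge_mem⟩ 1) =
      Pi.single ⟨y, h.left_mem⟩ 1 + Pi.single ⟨z, h.right_mem⟩ 1 := by
  obtain ⟨d, rfl⟩ := Γ.exists_edge e h.edge_mem
  have key (x : V(G)) : edgeBoundary p (Pi.single ⟨Γ.edge d, h.edge_mem⟩ 1) x =
      (if Γ.vert d = x then 1 else 0) + if Γ.vert (Γ.opp d) = x then 1 else 0 := by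
    rw [← sum_path_eq p, ← sum_path_eq p, ← Finset.sum_add_distrib, edgeBoundary_apply]
    refine Finset.sum_congr rfl fun i _ => ?_
    simp only [Pi.single_apply, Subtype.mk.injEq, eq_comm (b := Γ.edge d), Γ.edge_eq_iff]
    by_cases h₁ : (p x i : D) = d
    · simp [h₁, (Γ.opp_ne d).symm]
    · simp [h₁]
  funext x
  rw [key, Pi.add_apply, Pi.single_apply, Pi.single_apply]
  simp only [Subtype.ext_iff, eq_comm (a := (x : V))]
  obtain ⟨rfl, rfl⟩ | ⟨rfl, rfl⟩ := (Γ.isLink d).eq_and_eq_or_eq_and_eq h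
  · rfl
  · rw [add_comm]

/-- The color passes unchanged across half-edges, around vertices and along edges, hence along walks
in the connected graph. -/
lemma constant_of_faceCoboundary_eq_zero {Γ : RibbonGraph G D} (hG : IsConnected G)
    {g : Γ.Face → ZMod 2} (hg : Γ.faceCoboundary g = 0) (s t : D × Bool) :
    g (Γ.circle _ s) = g (Γ.circle _ t) := by
  have h_side (d) : g (Γ.circle _ (d, false)) = g (Γ.circle _ (d, true)) := by
    rw [← sideDiff_eq_zero_iff, ← faceCoboundary_apply, hg]
    rfl
  have h_side' (d β) : g (Γ.circle _ (d, β)) = g (Γ.circle _ (d, true)) := by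
    cases β
    exacts [h_side d, rfl]
  have h_rot (d) : g (Γ.circle _ (Γ.rot d, true)) = g (Γ.circle _ (d, true)) := by
    rw [circle_corner _ _ d, h_side]
  have h_opp (d) : g (Γ.circle _ (Γ.opp d, true)) = g (Γ.circle _ (d, true)) := by
    rw [← Γ.circle_across _ (d, true), across]
    exact (h_side' (Γ.opp d) _).symm
  have h_zpow (n : ℤ) (d) : g (Γ.circle _ ((Γ.rot ^ n) d, true)) = g (Γ.circle _ (d, true)) := by
    induction n using Int.induction_on with
    | zero => rfl
    | succ n ih => rw [add_comm, zpow_add, zpow_one, Equiv.Perm.mul_apply, h_rot, ih]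
    | pred n ih =>
      rw [← h_rot, ← ih, ← Equiv.Perm.mul_apply, ← zpow_one_add]
      congr 5
      ring
  have h_vert (d d') (h : Γ.vert d = Γ.vert d') :
      g (Γ.circle _ (d, true)) = g (Γ.circle _ (d', true)) := by
    obtain ⟨n, rfl⟩ := (Γ.rot_sameCycle d d').2 h
    exact (h_zpow n d).symm
  have h_walk {x y} (h : Relation.ReflTransGen G.Adj x y) :
      ∀ d, Γ.vert d = x → ∀ d', Γ.vert d' = y →
        g (Γ.circle _ (d, true)) = g (Γ.circle _ (d', true)) := by
    induction h with
    | refl => exact fun d hd d' hd' => h_vert d d' (hd.trans hd'.symm)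
    | tail _ hyz ih =>
      intro d hd d' hd'
      obtain ⟨e, he⟩ := hyz
      obtain ⟨d₀, rfl⟩ := Γ.exists_edge e he.edge_mem
      obtain ⟨h₁, h₂⟩ | ⟨h₁, h₂⟩ := (Γ.isLink d₀).eq_and_eq_or_eq_and_eq he
      · rw [ih d hd d₀ h₁, ← h_opp, h_vert _ d' (h₂.trans hd'.symm)]
      · rw [ih d hd _ h₂, h_opp, h_vert _ d' (h₁.trans hd'.symm)]
  obtain ⟨d, β⟩ := s
  obtain ⟨d', β'⟩ := t
  rw [h_side', h_side' d']
  exact h_walk (hG.2 _ (Γ.vert_mem d) _ (Γ.vert_mem d')) d rfl d' rfl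

/-- A walk from a base vertex to `y` has boundary the sum of its ends, so the range and the base
vertex together span everything. -/
lemma card_vertexSet_le [Finite V] {Γ : RibbonGraph G D} (hG : IsConnected G)
    (p : Γ.PathChoice) : Nat.card V(G) ≤ Module.finrank (ZMod 2) (edgeBoundary p).range + 1 := by
  classical
  have := Fintype.ofFinite V(G)
  have h_two (u : V(G) → ZMod 2) : u + u = 0 := funext fun _ => CharTwo.add_self_eq_zero _
  obtain ⟨x₀, hx₀⟩ := hG.1
  have h_walk {y} (h : Relation.ReflTransGen G.Adj x₀ y) :
      ∀ hy : y ∈ V(G), (Pi.single ⟨y, hy⟩ 1 + Pi.single ⟨x₀, hx₀⟩ 1 : V(G) → ZMod 2) ∈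
        (edgeBoundary p).range := by
    induction h with
    | refl => exact fun _ => by rw [h_two]; exact zero_mem _
    | @tail y z _ hyz ih =>
      intro hz
      obtain ⟨e, he⟩ := hyz
      have := add_mem (ih he.left_mem) ⟨_, edgeBoundary_single p he⟩
      rwa [add_comm, add_comm (Pi.single ⟨y, _⟩ 1 : V(G) → ZMod 2) (Pi.single ⟨z, _⟩ 1), add_assoc,
        ← add_assoc (Pi.single ⟨y, _⟩ 1 : V(G) → ZMod 2), h_two,
        zero_add] at this
  have h_top : (edgeBoundary p).range ⊔ ZMod 2 ∙ (Pi.single ⟨x₀, hx₀⟩ 1 : V(G) → ZMod 2) = ⊤ := by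
    refine eq_top_iff.2 fun u _ => ?_
    rw [← Finset.univ_sum_single u]
    refine Submodule.sum_mem _ fun x _ => ?_
    have h₁ := Submodule.mem_sup_left (T := ZMod 2 ∙ (Pi.single ⟨x₀, hx₀⟩ 1 : V(G) → ZMod 2))
      (h_walk (hG.2 _ hx₀ _ x.2) x.2)
    have h₂ := sub_mem h₁ (Submodule.mem_sup_right (Submodule.mem_span_singleton_self _))
    rw [add_sub_cancel_right] at h₂
    simpa [← Pi.single_smul'] using Submodule.smul_mem _ (u x) h₂
  calc Nat.card V(G) = Module.finrank (ZMod 2) (⊤ : Submodule (ZMod 2) (V(G) → ZMod 2)) := by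
        rw [finrank_top, Module.finrank_fintype_fun_eq_card, Nat.card_eq_fintype_card]
    _ ≤ _ := by
        rw [← h_top]
        refine (Submodule.finrank_add_le_finrank_add_finrank _ _).trans ?_
        gcongr
        exact (finrank_span_le_card _).trans (by simp)

/-- On a plane graph, every cycle modulo two bounds a set of faces. -/
lemma IsPlane.range_faceCoboundary [Finite V] [Finite D] {Γ : RibbonGraph G D} (hΓ : Γ.IsPlane)
    (p : Γ.PathChoice) : Γ.faceCoboundary.range = (edgeBoundary p).ker := by
  have := Γ.finite_edgeSet
  have := Fintype.ofFinite E(G)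
  have := Fintype.ofFinite V(G)
  obtain ⟨hG, hχ⟩ := hΓ
  refine Submodule.eq_of_le_of_finrank_le ?_ ?_
  · rintro _ ⟨g, rfl⟩
    exact edgeBoundary_faceCoboundary p g
  have h_ker : Module.finrank (ZMod 2) Γ.faceCoboundary.ker ≤ 1 := by
    refine (Submodule.finrank_mono (t := ZMod 2 ∙ (1 : Γ.Face → ZMod 2)) fun g hg => ?_).trans
      ((finrank_span_le_card _).trans (by simp))
    obtain ⟨x₀, hx₀⟩ := hG.1
    refine Submodule.mem_span_singleton.2 ⟨g (Γ.circle _ (p ⟨x₀, hx₀⟩ 0, true)), funext fun c => ?_⟩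
    obtain ⟨s, rfl⟩ : ∃ s, Γ.circle _ s = c := Quotient.exists_rep c
    rw [Pi.smul_apply, Pi.one_apply, smul_eq_mul, mul_one]
    exact constant_of_faceCoboundary_eq_zero hG hg _ _
  have h_vert := card_vertexSet_le hG p
  have h₁ := Γ.faceCoboundary.finrank_range_add_finrank_ker
  have h₂ := (edgeBoundary p).finrank_range_add_finrank_ker
  rw [Module.finrank_fintype_fun_eq_card, ← Nat.card_eq_fintype_card] at h₁ h₂
  rw [← Nat.card_coe_set_eq, ← Nat.card_coe_set_eq] at hχ
  -- With V - E + F = 2, the kernel of the boundary has dimension at most E - (V - 1) = F - 1, and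
  -- the coboundary has rank at least F - 1.
  omega

/-! ### Colorings of the faces and perfect matchings -/

/-- The edges with the same color on both sides. -/
def sameSides {Γ : RibbonGraph G D} (g : Γ.Face → ZMod 2) : Set E :=
  {e | ∃ d, Γ.edge d = e ∧ sideDiff g d = 0}

lemma edge_mem_sameSides {Γ : RibbonGraph G D} {g : Γ.Face → ZMod 2} {d : D} :
    Γ.edge d ∈ sameSides g ↔ sideDiff g d = 0 := by
  refine ⟨?_, fun h => ⟨d, rfl, h⟩⟩
  rintro ⟨d', h, h'⟩
  obtain rfl | rfl := (Γ.edge_eq_iff _ _).1 h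
  · exact h'
  · rwa [sideDiff_opp]

/-- An even, non-zero number of ones among three entries is two. -/
lemma sum_eq_zero_and_exists_ne_zero_iff (w : Fin 3 → ZMod 2) :
    (∑ i, w i = 0 ∧ ∃ i, w i ≠ 0) ↔ ∃! i, w i = 0 := by
  revert w
  unfold ExistsUnique
  decide

lemma isPerfectMatching_sameSides_iff {Γ : RibbonGraph G D} (p : Γ.PathChoice)
    (g : Γ.Face → ZMod 2) : IsPerfectMatching G (sameSides g) ↔
      ∀ x : V(G), ∃ d, Γ.vert d = x ∧ g (Γ.circle _ (d, false)) ≠ g (Γ.circle _ (d, true)) := by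
  rw [isPerfectMatching_iff p, and_iff_right]
  · refine forall_congr' fun x => ?_
    simp only [edge_mem_sameSides]
    rw [← sum_eq_zero_and_exists_ne_zero_iff, and_iff_right (sum_sideDiff p g x)]
    simp only [ne_eq, ← sideDiff_eq_zero_iff]
    constructor
    · rintro ⟨i, hi⟩
      exact ⟨_, p.vert_eq x i, hi⟩
    · rintro ⟨d, hd, h⟩
      obtain ⟨i, rfl⟩ := p.exists_eq hd
      exact ⟨i, h⟩
  · rintro _ ⟨d, rfl, -⟩
    exact Γ.edge_mem d

/-- The indicator of the complement of `M` has two ones at every vertex, so it is a cycle, and on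
the sphere it is a coboundary of faces. -/
lemma IsPlane.exists_sameSides_eq [Finite V] [Finite D] {Γ : RibbonGraph G D} (hΓ : Γ.IsPlane)
    (p : Γ.PathChoice) {M : Set E} (hM : IsPerfectMatching G M) :
    ∃ g : Γ.Face → ZMod 2, sameSides g = M := by
  classical
  rw [isPerfectMatching_iff p] at hM
  have hu : (fun e : E(G) => if (e : E) ∈ M then (0 : ZMod 2) else 1) ∈ (edgeBoundary p).ker := by
    rw [LinearMap.mem_ker]
    funext x
    rw [edgeBoundary_apply]
    refine ((sum_eq_zero_and_exists_ne_zero_iff _).2 ?_).1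
    simpa using hM.2 x
  rw [← hΓ.range_faceCoboundary p] at hu
  obtain ⟨g, hg⟩ := hu
  refine ⟨g, Set.ext fun e => ?_⟩
  by_cases he : e ∈ E(G)
  · obtain ⟨d, rfl⟩ := Γ.exists_edge e he
    rw [edge_mem_sameSides, ← faceCoboundary_apply, hg]
    simp
  · refine iff_of_false ?_ fun h => he (hM.1 h)
    rintro ⟨d, rfl, -⟩
    exact he (Γ.edge_mem d)

/-- A perfect matching of a plane graph is the set of edges with the same color on both sides for
exactly two colorings of the faces. -/
lemma IsPlane.card_colorings [Finite V] [Finite D] {Γ : RibbonGraph G D} (hΓ : Γ.IsPlane)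
    (p : Γ.PathChoice) :
    Nat.card {g : Γ.Face → ZMod 2 // ∀ x : V(G), ∃ d, Γ.vert d = x ∧
      g (Γ.circle _ (d, false)) ≠ g (Γ.circle _ (d, true))} =
      2 * {M : Set E | IsPerfectMatching G M}.ncard := by
  obtain ⟨x₀, hx₀⟩ := hΓ.1.1
  let s₀ : D × Bool := (p ⟨x₀, hx₀⟩ 0, true)
  let φ : {g : Γ.Face → ZMod 2 // ∀ x : V(G), ∃ d, Γ.vert d = x ∧
      g (Γ.circle _ (d, false)) ≠ g (Γ.circle _ (d, true))} →
      ZMod 2 × {M : Set E | IsPerfectMatching G M} :=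
    fun g => (g.1 (Γ.circle _ s₀), ⟨sameSides g.1, (isPerfectMatching_sameSides_iff p g.1).2 g.2⟩)
  have hφ : Function.Bijective φ := by
    constructor
    · rintro ⟨g, hg⟩ ⟨g', hg'⟩ h
      simp only [φ, Prod.mk.injEq, Subtype.mk.injEq] at h
      -- An element of the field with two elements is determined by whether it vanishes, so equal
      -- matchings give equal coboundaries.
      have hz (c c' : ZMod 2) (h : c = 0 ↔ c' = 0) : c - c' = 0 := by revert c c'; decide
      have hker : Γ.faceCoboundary (g - g') = 0 := by
        funext e
        obtain ⟨e, he⟩ := e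
        obtain ⟨d, rfl⟩ := Γ.exists_edge e he
        rw [map_sub, Pi.sub_apply, faceCoboundary_apply, faceCoboundary_apply]
        refine hz _ _ ?_
        rw [← edge_mem_sameSides, h.2, edge_mem_sameSides]
      refine Subtype.ext (funext fun c => ?_)
      obtain ⟨s, rfl⟩ : ∃ s, Γ.circle _ s = c := Quotient.exists_rep c
      have := constant_of_faceCoboundary_eq_zero hΓ.1 hker s s₀
      simp only [Pi.sub_apply] at this
      rwa [h.1, sub_self, sub_eq_zero] at this
    · rintro ⟨c, M, hM⟩
      obtain ⟨g, rfl⟩ := hΓ.exists_sameSides_eq p hM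
      -- Adding a constant to all colors adjusts the color at `s₀` without changing the matching.
      obtain ⟨g', hs, hc⟩ : ∃ g' : Γ.Face → ZMod 2,
          sameSides g' = sameSides g ∧ g' (Γ.circle _ s₀) = c :=
        ⟨fun F => g F + (c - g (Γ.circle _ s₀)),
          by simp only [sameSides, sideDiff_eq_zero_iff, add_left_inj], by simp⟩
      exact ⟨⟨g', (isPerfectMatching_sameSides_iff p g').1 (by rwa [hs])⟩, by simp [φ, hs, hc]⟩
  rw [Nat.card_congr (Equiv.ofBijective φ hφ), Nat.card_prod, Nat.card_zmod, Nat.card_coe_set_eq]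

end RibbonGraph

/-! ### The homology in degree zero -/

/-- The common kernel of linear maps each of which kills some vectors of a basis and is injective on
the span of the others. -/
lemma finrank_iInf_ker_eq_card {ι X K W : Type*} [Field K] [AddCommGroup W] [Module K W] [Finite ι]
    {W' : X → Type*} [∀ x, AddCommGroup (W' x)] [∀ x, Module K (W' x)]
    (b : Module.Basis ι K W) (N : ∀ x, W →ₗ[K] W' x) (A : X → ι → Prop)
    (hzero : ∀ x i, ¬ A x i → N x (b i) = 0)
    (hind : ∀ x, LinearIndependent K fun i : {i // A x i} => N x (b i)) :
    Module.finrank K (⨅ x, (N x).ker : Submodule K W) = Nat.card {i // ∀ x, ¬ A x i} := by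
  classical
  have := Fintype.ofFinite ι
  have h_span : (⨅ x, (N x).ker : Submodule K W) =
      Submodule.span K (Set.range fun i : {i // ∀ x, ¬ A x i} => b i) := by
    refine le_antisymm (fun v hv => ?_) (Submodule.span_le.2 ?_)
    -- In `N x v = 0` the killed basis vectors drop out; independence of the remaining images makes
    -- their coefficients zero.
    · have h_coord (x) (i) (hi : A x i) : b.repr v i = 0 := by
        have h₁ : ∑ i : {i // A x i}, b.repr v i • N x (b i) = 0 := by
          have h₂ : N x v = 0 := (Submodule.mem_iInf _).1 hv x
          rw [← b.sum_repr v, map_sum] at h₂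
          simp only [map_smul] at h₂
          rwa [← Fintype.sum_subtype_add_sum_subtype (A x),
            Fintype.sum_eq_zero (fun i : {i // ¬ A x i} => b.repr v i • N x (b i)) fun i => by
              rw [hzero x i i.2, smul_zero], add_zero] at h₂
        exact Fintype.linearIndependent_iff.1 (hind x) _ h₁ ⟨i, hi⟩
      rw [← b.sum_repr v]
      refine Submodule.sum_mem _ fun i _ => ?_
      by_cases hi : ∀ x, ¬ A x i
      · exact Submodule.smul_mem _ _ (Submodule.subset_span ⟨⟨i, hi⟩, rfl⟩)
      · push Not at hi
        obtain ⟨x, hx⟩ := hi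
        rw [h_coord x i hx, zero_smul]
        exact zero_mem _
    · rintro _ ⟨i, rfl⟩
      exact (Submodule.mem_iInf _).2 fun x => hzero x i (i.2 x)
  rw [h_span, Nat.card_eq_fintype_card]
  exact finrank_span_eq_card (b.linearIndependent.comp _ Subtype.val_injective)

namespace RibbonGraph

variable {V : Type u} {E : Type v} {D : Type w} {G : Graph V E}

/-- In degree zero there is only the all-zero state. -/
def generatorZeroEquiv (Γ : RibbonGraph G D) :
    Γ.Monomial 2 (Γ.vertexState ∅) ≃ Γ.Generator 2 0 where
  toFun I := ⟨⟨∅, by simp⟩, I⟩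
  invFun g := cast (by
    have : g.1.1 = ∅ := Finset.card_eq_zero.1 (by exact_mod_cast g.1.2.2)
    rw [this]) g.2
  left_inv I := rfl
  right_inv g := by
    obtain ⟨⟨ν, h₁, h₂⟩, I⟩ := g
    obtain rfl : ν = ∅ := Finset.card_eq_zero.1 (by exact_mod_cast h₂)
    rfl

variable [Fintype V] [LinearOrder V] [Finite D]

-- A state with one `1`-smoothed vertex is reached from the empty state only by changing that
-- vertex, with sign +1, so the components of the differential are the local maps.
open scoped Classical in
lemma mem_ker_differential_zero_iff {Γ : RibbonGraph G D} (p : Γ.PathChoice)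
    [Fintype (Γ.Monomial 2 (Γ.vertexState ∅))] (v : Γ.Chain 2 0) :
    v ∈ (Γ.differential p 2 0 (0 + 1)).ker ↔ v ∘ Γ.generatorZeroEquiv ∈
      (⨅ x : V(G), (Γ.vertexMap p 2 x ∅ {(x : V)}).mulVecLin.ker : Submodule ℂ _) := by
  let _ : Fintype (Γ.Generator 2 0) := Fintype.ofFinite _
  have key (g' : Γ.Generator 2 (0 + 1)) (x : V(G)) (hx : g'.1.1 = {(x : V)}) :
      Γ.differential p 2 0 (0 + 1) v g' =
        (Γ.vertexMap p 2 x ∅ g'.1.1).mulVec (v ∘ Γ.generatorZeroEquiv) g'.2 := by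
    simp only [differential, Matrix.mulVecLin_apply, Matrix.mulVec, dotProduct, Matrix.of_apply]
    rw [← Equiv.sum_comp Γ.generatorZeroEquiv]
    refine Finset.sum_congr rfl fun I _ => ?_
    rw [Finset.sum_eq_single x]
    · simp [generatorZeroEquiv, hx]
    · intro y _ hyx
      rw [if_neg]
      rintro ⟨-, h⟩
      simp [generatorZeroEquiv, hx] at h
      exact hyx (Subtype.ext h.symm)
    · simp
  rw [Submodule.mem_iInf, LinearMap.mem_ker]
  constructor
  · intro hv x
    rw [LinearMap.mem_ker]
    funext J
    have := key ⟨⟨{(x : V)}, by simp, by simp⟩, J⟩ x rfl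
    rw [hv] at this
    exact this.symm
  · intro hv
    funext g'
    obtain ⟨x, hx⟩ := Finset.card_eq_one.1 (show g'.1.1.card = 1 by exact_mod_cast g'.1.2.2)
    have hxG : x ∈ V(G) := g'.1.2.1 (by simp [hx])
    rw [key g' ⟨x, hxG⟩ hx]
    obtain ⟨⟨ν, h₁, h₂⟩, J⟩ := g'
    obtain rfl : ν = {x} := hx
    exact congrFun (LinearMap.mem_ker.1 (hv ⟨x, hxG⟩)) J

/-- In degree zero the homology is the kernel of the differential. -/
lemma finrank_filteredVertexHomology_zero (Γ : RibbonGraph G D) (p : Γ.PathChoice) :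
    Module.finrank ℂ (Γ.FilteredVertexHomology p 2 0) =
      Module.finrank ℂ (Γ.differential p 2 0 (0 + 1)).ker := by
  have h_empty : IsEmpty (Γ.Generator 2 (0 - 1)) := ⟨fun g => by
    have := g.1.2.2
    omega⟩
  have h_range : (Γ.differential p 2 (0 - 1) 0).range = ⊥ := by
    rw [LinearMap.range_eq_bot]
    exact Subsingleton.elim _ _
  refine (Submodule.quotEquivOfEqBot _ ?_).finrank_eq
  rw [h_range, Submodule.submoduleOf, Submodule.comap_bot, Submodule.ker_subtype]

lemma finrank_filteredVertexHomology_zero_eq_card (Γ : RibbonGraph G D) (p : Γ.PathChoice) :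
    Module.finrank ℂ (Γ.FilteredVertexHomology p 2 0) =
      Nat.card {g : Γ.Face → ZMod 2 // ∀ x : V(G), ∃ d, Γ.vert d = x ∧
        g (Γ.circle _ (d, false)) ≠ g (Γ.circle _ (d, true))} := by
  classical
  have h_state : (fun _ => false : Γ.State) = Γ.vertexState ∅ := by
    funext d
    simp [vertexState]
  let e : Γ.Chain 2 0 ≃ₗ[ℂ] (Γ.Monomial 2 (Γ.vertexState ∅) → ℂ) :=
    LinearEquiv.funCongrLeft ℂ ℂ Γ.generatorZeroEquiv
  have h_ker : (Γ.differential p 2 0 (0 + 1)).ker.map (e : Γ.Chain 2 0 →ₗ[ℂ] _) =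
      ⨅ x : V(G), (Γ.vertexMap p 2 x ∅ {(x : V)}).mulVecLin.ker := by
    ext v
    obtain ⟨v, rfl⟩ := e.surjective v
    refine Iff.trans ?_ (mem_ker_differential_zero_iff p v)
    rw [Submodule.mem_map_equiv, e.symm_apply_apply]
  rw [finrank_filteredVertexHomology_zero, ← LinearEquiv.finrank_map_eq e, h_ker,
    finrank_iInf_ker_eq_card (Γ.coloringBasis _) _ fun (x : V(G)) g => ∀ d, Γ.vert d = x →
      g (Γ.circle _ (d, false)) = g (Γ.circle _ (d, true))]
  -- Faces are circles of the constant state, which equals `vertexState ∅` only propositionally.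
  · unfold Face
    rw [h_state]
    simp only [not_forall, exists_prop, ne_eq]
  · intro x g hg
    rw [coloringBasis_apply, Matrix.mulVecLin_apply]
    refine (isColored_coloringVector g).vertexMap_mulVec_eq_zero p x (by simp) (by simp) ?_
    simpa using hg
  · intro x
    simp only [coloringBasis_apply, Matrix.mulVecLin_apply]
    exact linearIndependent_vertexMap_mulVec p x (by simp) (by simp)

end RibbonGraph

end VertexHomology

end

theorem theorem2 {V E D : Type*} [Fintype V] [LinearOrder V] [Finite D] (G : Graph V E)
    (hconn : VertexHomology.IsConnected G) (htri : VertexHomology.IsTrivalent G)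
    (Γ : VertexHomology.RibbonGraph G D) (hΓ : Γ.IsPlane) (p : Γ.PathChoice) :
    Module.finrank ℂ (Γ.FilteredVertexHomology p 2 0) =
      2 * {M : Set E | VertexHomology.IsPerfectMatching G M}.ncard := by
  rw [Γ.finrank_filteredVertexHomology_zero_eq_card p, hΓ.card_colorings p]
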